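/- **Setting.** Let $G=(V,E)$ be a finite simple graph with edge weights $w_{ij}>0$, $(ij)\in E$, and integer capacities $b_i\ge 1$, $i\in V$; write $\partial i$ for the set of neighbours of $i$ and $(x)_+=\max(x,0)$. For $b\ge1$, $b\text{-}\max$ of a finite family of non-negative reals is its $b$-th largest entry (with multiplicity), or $0$ if the family has fewer than $b$ entries. *Matchings and the LP.* A set $M\subseteq E$ is a $b$-matching if the degree $d_i(M)$ of $i$ in $(V,M)$ is at most $b_i$ for all $i$; $i$ is saturated if $d_i(M)=b_i$. The $b$-matching LP is: maximize $\sum_{(ij)\in E}x_{ij}w_{ij}$ subject to $\sum_{j\in\partial i}x_{ij}\le b_i$ for all $i\in V$ and $0\le x_{ij}\le 1$ for all $(ij)\in E$. *Nash bargaining (NB) solutions.* A trade outcome is a pair $(M,\Gamma)$ with $M$ a $b$-matching and $\Gamma=(\gamma_{i\to j},\gamma_{j\to i})_{(ij)\in E}$ non-negative reals such that $\gamma_{i\to j}=\gamma_{j\to i}=0$ if $(ij)\notin M$ and $\gamma_{i\to j}+\gamma_{j\to i}=w_{ij}$ if $(ij)\in M$. Put $\gamma_i=\min_{j:(ij)\in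 M}\gamma_{j\to i}$ if $i$ is saturated and $\gamma_i=0$ otherwise. An NB solution is a trade outcome that is stable, i.e. $\gamma_i+\gamma_j\ge w_{ij}$ for all $(ij)\in E\setminus M$, and balanced, i.e. for all $(ij)\in M$ $$\gamma_{j\to i}-b_i\text{-}\max_{k\in\partial i\setminus j}(w_{ik}-\gamma_k)_+=\gamma_{i\to j}-b_j\text{-}\max_{l\in\partial j\setminus i}(w_{jl}-\gamma_l)_+ .$$ *Natural dynamics.* Fix $\kappa\in(0,1)$. A vector $\alpha=(\alpha_{i\to j},\alpha_{j\to i})_{(ij)\in E}$ of non-negative reals determines the offers $$m_{i\to j}=(w_{ij}-\alpha_{i\to j})_+-\tfrac12(w_{ij}-\alpha_{i\to j}-\alpha_{j\to i})_+ ,$$ and is updated to the vector with entries $(1-\kappa)\alpha_{i\to j}+\kappa\; b_i\text{-}\max_{k\in\partial i\setminus j}m_{k\to i}$. A fixed point is a triple $(\alpha,m,\Gamma)$ where $\alpha$ is unchanged by the update, $m$ is the vector of offers determined by $\alpha$, and $\gamma_{j\to i}=m_{j\to i}$ if $m_{j\to i}$ is among the top $b_i$ incoming offers to $i$, $\gamma_{j\to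 i}=0$ otherwise, for some way of breaking ties in ordering the incoming offers. *Induced matching.* $\alpha$ induces the $b$-matching $M$ if, for every $i\in V$: when $i$ receives at least $b_i$ positive offers, there is no tie for the $b_i$-th highest offer (the set of the $b_i$ highest incoming offers is unambiguous) and the partners of $i$ under $M$ are exactly the $b_i$ neighbours making its $b_i$ highest offers; when $i$ receives fewer than $b_i$ positive offers, its partners under $M$ are exactly the neighbours from whom it receives a positive offer. **Theorem.** Suppose that the $b$-matching LP has a unique optimum and that it is integral, equal to the $0/1$ indicator vector of $M^*\subseteq E$. 1. If $(\alpha,m,\Gamma)$ is a fixed point of the natural dynamics, then $\alpha$ induces $M^*$ and $(M^*,\Gamma)$ is a Nash bargaining solution. 2. Conversely, if $(M,\Gamma_{\mathrm{NB}})$ is a Nash bargaining solution, then $M=M^*$, and there is a unique fixed point $(\alpha,m,\Gamma)$ of the natural dynamics with $\Gamma=\Gamma_{\mathrm{NB}}$. -/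

import Mathlib

noncomputable section

/-- `bMax b s f` is the `b`-th largest entry (`b ≥ 1`, counted with multiplicity) of the finite
family `(f k)_{k ∈ s}`, and `0` if the family has fewer than `b` entries. -/
def bMax {ι : Type*} (b : ℕ) (s : Finset ι) (f : ι → ℝ) : ℝ :=
  ((s.val.map f).sort (· ≥ ·)).getD (b - 1) 0

/-- A bargaining network: a simple graph with positive edge weights and positive integer capacities
at the vertices. -/
structure BargainingNetwork (V : Type*) where
  graph : SimpleGraph V
  weight : graph.edgeSet → ℝ
  weight_pos : ∀ e, 0 < weight e
  cap : V → ℕ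
  cap_pos : ∀ i, 0 < cap i

namespace BargainingNetwork

variable {V : Type*} [Fintype V] (N : BargainingNetwork V)

/-- The oriented edges. The dart `d` with `d.fst = i`, `d.snd = j` is the index `i → j`, and
`d.symm` is `j → i`; a vector in `ℝ^{2|E|}` is a function on darts. -/
abbrev Arc : Type _ := N.graph.Dart

/-- The unoriented edge under an oriented edge. -/
def edge {N : BargainingNetwork V} (d : N.Arc) : N.graph.edgeSet := ⟨d.edge, d.edge_mem⟩

open scoped Classical in
/-- The arcs `k → i` with `k` a neighbour of `i`. -/
def incoming (i : V) : Finset N.Arc := Finset.univ.filter fun d => d.snd = i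

/-! ### The linear program -/

open scoped Classical in
/-- `x` is feasible for the primal LP: `∑_{j ∈ ∂i} x_{ij} ≤ b_i` at every vertex `i`, and
`0 ≤ x_{ij} ≤ 1` on every edge. -/
def IsLPFeasible (x : N.graph.edgeSet → ℝ) : Prop :=
  (∀ i : V, ∑ e ∈ Finset.univ.filter (fun e : N.graph.edgeSet => i ∈ (e : Sym2 V)), x e
      ≤ (N.cap i : ℝ)) ∧
    ∀ e, 0 ≤ x e ∧ x e ≤ 1

open scoped Classical in
/-- The objective `∑_{(ij) ∈ E} x_{ij} w_{ij}` of the primal LP. -/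
def lpValue (x : N.graph.edgeSet → ℝ) : ℝ := ∑ e, x e * N.weight e

/-- `x` is an optimum of the primal LP. -/
def IsLPOptimum (x : N.graph.edgeSet → ℝ) : Prop :=
  N.IsLPFeasible x ∧ ∀ x', N.IsLPFeasible x' → N.lpValue x' ≤ N.lpValue x

open scoped Classical in
/-- The `0/1` vector of a set of edges. -/
def edgeIndicator (M : Finset N.graph.edgeSet) : N.graph.edgeSet → ℝ :=
  fun e => if e ∈ M then 1 else 0

/-! ### Nash bargaining solutions -/

open scoped Classical in
/-- The degree `d_i(M)` of `i` in the graph `(V, M)`. -/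
def degreeIn (M : Finset N.graph.edgeSet) (i : V) : ℕ :=
  (M.filter fun e => i ∈ (e : Sym2 V)).card

/-- `M` is a `b`-matching. -/
def IsBMatching (M : Finset N.graph.edgeSet) : Prop := ∀ i, N.degreeIn M i ≤ N.cap i

/-- `(M, Γ)` is a trade outcome; `Γ d` for `d = (i → j)` is `γ_{i → j}`, the amount that `j` gets
from the trade with `i`. -/
def IsTradeOutcome (M : Finset N.graph.edgeSet) (Γ : N.Arc → ℝ) : Prop :=
  N.IsBMatching M ∧
    (∀ d, 0 ≤ Γ d) ∧
    (∀ d, edge d ∉ M → Γ d = 0) ∧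
    (∀ d, edge d ∈ M → Γ d + Γ d.symm = N.weight (edge d))

open scoped Classical in
/-- `γ_i`: the minimum of `γ_{j → i}` over the partners `j` of `i` if `i` is saturated under `M`,
and `0` if `i` is not saturated. (A saturated vertex has a partner, as capacities are positive.) -/
def gain (M : Finset N.graph.edgeSet) (Γ : N.Arc → ℝ) (i : V) : ℝ :=
  if N.degreeIn M i = N.cap i then sInf (Γ '' {d | d.snd = i ∧ edge d ∈ M}) else 0

/-- Stability: `γ_i + γ_j ≥ w_{ij}` for every edge `(ij) ∉ M`. -/
def IsStable (M : Finset N.graph.edgeSet) (Γ : N.Arc → ℝ) : Prop :=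
  ∀ d : N.Arc, edge d ∉ M → N.weight (edge d) ≤ N.gain M Γ d.fst + N.gain M Γ d.snd

open scoped Classical in
/-- For the arc `d = (j → i)`: the `b_i`-th largest of the numbers `f (k → i)`, where `k` runs over
the neighbours of `i` other than `j`. -/
def bMaxOthers (f : N.Arc → ℝ) (d : N.Arc) : ℝ :=
  bMax (N.cap d.snd) ((N.incoming d.snd).erase d) f

/-- Balance on every edge of `M`. For the arc `e = (k → i)`, the number
`max (w_e - γ_{e.fst}) 0` is `(w_{ik} - γ_k)_+`. -/
def IsBalanced (M : Finset N.graph.edgeSet) (Γ : N.Arc → ℝ) : Prop :=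
  ∀ d : N.Arc, edge d ∈ M →
    Γ d - N.bMaxOthers (fun e => max (N.weight (edge e) - N.gain M Γ e.fst) 0) d =
      Γ d.symm - N.bMaxOthers (fun e => max (N.weight (edge e) - N.gain M Γ e.fst) 0) d.symm

/-- `(M, Γ)` is a Nash bargaining solution: a trade outcome that is stable and balanced. -/
def IsNashBargaining (M : Finset N.graph.edgeSet) (Γ : N.Arc → ℝ) : Prop :=
  N.IsTradeOutcome M Γ ∧ N.IsStable M Γ ∧ N.IsBalanced M Γ

/-! ### The natural dynamics -/

/-- The offers: `m_{i → j} = (w_{ij} - α_{i → j})_+ - ½ (w_{ij} - α_{i → j} - α_{j → i})_+`. -/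
def offer (α : N.Arc → ℝ) : N.Arc → ℝ := fun d =>
  max (N.weight (edge d) - α d) 0 - (1 / 2) * max (N.weight (edge d) - α d - α d.symm) 0

/-- One step of the natural dynamics with damping factor `κ`: `α_{i → j}` becomes
`(1 - κ) α_{i → j} + κ m`, with `m` the `b_i`-th largest of the offers `m_{k → i}`,
`k ∈ ∂i \ j`. -/
def update (κ : ℝ) (α : N.Arc → ℝ) : N.Arc → ℝ := fun d =>
  (1 - κ) * α d + κ * N.bMaxOthers (N.offer α) d.symm

open scoped Classical in
/-- `Γ` arises from the offers `m`: `γ_{j → i}` is `m_{j → i}` if this is among the top `b_i`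
incoming offers to `i`, and `0` otherwise, for some way to break ties. The set `T` is the chosen
set of top `b_i` incoming offers to `i` (of all of them, if there are fewer than `b_i`). -/
def IsTopOffers (m Γ : N.Arc → ℝ) : Prop :=
  ∀ i : V, ∃ T ⊆ N.incoming i,
    T.card = min (N.cap i) (N.incoming i).card ∧
    (∀ d ∈ T, ∀ e ∈ N.incoming i \ T, m e ≤ m d) ∧
    ∀ d ∈ N.incoming i, Γ d = if d ∈ T then m d else 0

/-- A triple `(α, m, Γ)` of vectors indexed by the oriented edges. -/
structure State where
  α : N.Arc → ℝ
  m : N.Arc → ℝ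
  Γ : N.Arc → ℝ

/-- `(α, m, Γ)` is a fixed point of the natural dynamics with damping factor `κ`: the messages
`α ≥ 0` are unchanged by an update, `m` is the vector of offers given by `α`, and `Γ` arises from
`m` for some way to break ties. -/
def IsFixedPoint (κ : ℝ) (s : N.State) : Prop :=
  (∀ d, 0 ≤ s.α d) ∧ Function.IsFixedPt (N.update κ) s.α ∧
    s.m = N.offer s.α ∧ N.IsTopOffers s.m s.Γ

open scoped Classical in
/-- The messages `α` induce the `b`-matching `M`. If `i` receives at least `b_i` positive offers,
then `i` has exactly `b_i` partners under `M`, and every offer from a partner is strictly higher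
than every offer from a non-partner (there is no tie for the `b_i`-th highest offer, and the
partners are the `b_i` neighbours with the highest offers). If `i` receives fewer than `b_i`
positive offers, then its partners are the neighbours from whom it receives a positive offer. -/
def Induces (α : N.Arc → ℝ) (M : Finset N.graph.edgeSet) : Prop :=
  N.IsBMatching M ∧ ∀ i : V,
    (N.cap i ≤ ((N.incoming i).filter fun d => 0 < N.offer α d).card →
      ((N.incoming i).filter fun d => edge d ∈ M).card = N.cap i ∧
      ∀ d ∈ N.incoming i, ∀ e ∈ N.incoming i, edge d ∈ M → edge e ∉ M →
        N.offer α e < N.offer α d) ∧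
    (((N.incoming i).filter fun d => 0 < N.offer α d).card < N.cap i →
      ∀ d ∈ N.incoming i, edge d ∈ M ↔ 0 < N.offer α d)

end BargainingNetwork

end

namespace BargainingNetwork

open Finset

/-! ### The `b`-th largest entry of a finite family -/

/-! At a fixed point `α_{i→j}` is the `b_i`-th largest offer to `i` from neighbours other than `j`,
so `κ` plays no role beyond `κ > 0`. Call `w_{ij} - α_{i→j} - α_{j→i}` the surplus of an edge. It is
positive exactly when the offer along the edge strictly beats the `b_i`-max of the others, so at
most `b_i` edges at `i` have positive surplus.

The `b_i`-th largest `y_i` of all offers to `i` acts as a dual variable: `y_i + y_j ≥ w_{ij}` where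
the surplus is `≤ 0`, and `≤ w_{ij}` where it is `≥ 0`. Edges violating "positive surplus on `M*`,
negative off it" link up into alternating walks that stop only at vertices with spare capacity or
with `y_i = 0`. Shifting the LP optimum slightly along such walks stays feasible and loses nothing,
contradicting uniqueness (`eq_empty_of_alternating`, `IsEquilibrium.slack_pos_and_neg`).

Once the signs are known, partners make the strictly highest offers, `γ_i = y_i`, and an offer and
`(w_{ik} - γ_k)_+` agree off `M*`; on the fewer than `b_i` other partners they differ without
affecting the `b_i`-max (`bMax_congr`). Balance then says that each side gets its best alternative
plus half the surplus.

Conversely, the gains `γ_i` of a Nash bargaining solution are an optimal dual solution, so its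
matching is `M*`. The messages can be read off from `Γ` (`messagesOf`), and these form a fixed
point; `IsEquilibrium.eq_messagesOf` gives uniqueness. -/

lemma _root_.List.le_getD_iff_le_countP {t : ℝ} (ht : 0 < t) :
    ∀ (l : List ℝ), l.Pairwise (· ≥ ·) → ∀ n : ℕ,
      (t ≤ l.getD n 0 ↔ n + 1 ≤ l.countP (fun x => decide (t ≤ x)))
  | [], _, n => by simp [ht]
  | a :: l, h, n => by
    rw [List.pairwise_cons] at h
    by_cases ha : t ≤ a
    · rw [List.countP_cons_of_pos (by simpa using ha)]
      cases n with
      | zero => simp [ha]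
      | succ n =>
        rw [List.getD_cons_succ, List.le_getD_iff_le_countP ht l h.2 n]
        omega
    · have h0 : (a :: l).countP (fun x => decide (t ≤ x)) = 0 := by
        rw [List.countP_eq_zero]
        intro x hx
        rcases List.mem_cons.1 hx with rfl | hx
        · simpa using ha
        · have := h.1 x hx
          simp only [decide_eq_true_eq, not_le]
          exact lt_of_le_of_lt this (not_le.1 ha)
      rw [h0]
      cases n with
      | zero => simpa using ha
      | succ n =>
        have h1 := List.le_getD_iff_le_countP ht l h.2 n
        have h2 : l.countP (fun x => decide (t ≤ x)) = 0 := by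
          rw [List.countP_cons] at h0
          omega
        rw [List.getD_cons_succ, h1, h2]
        omega

section bMax

variable {ι : Type*} {b : ℕ} {s : Finset ι} {f f' : ι → ℝ} {t : ℝ}

/-- Reduces order statistics to counting. Only positive levels are allowed: the default value `0` of
a short family would reach level `0` without any entry doing so. -/
lemma le_bMax_iff (hb : 0 < b) (ht : 0 < t) :
    t ≤ bMax b s f ↔ b ≤ #{k ∈ s | t ≤ f k} := by
  unfold bMax
  rw [List.le_getD_iff_le_countP ht _ (Multiset.pairwise_sort _ _), Nat.sub_add_cancel hb]
  have : List.countP (fun x => decide (t ≤ x)) ((s.val.map f).sort (· ≥ ·))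
      = #{k ∈ s | t ≤ f k} := by
    rw [← Multiset.coe_countP, Multiset.sort_eq, Multiset.countP_map]
    rfl
  rw [this]

lemma bMax_nonneg (hf : ∀ k, 0 ≤ f k) : 0 ≤ bMax b s f := by
  unfold bMax
  rw [List.getD_eq_getElem?_getD]
  cases h : ((s.val.map f).sort (· ≥ ·))[b - 1]? with
  | none => simp
  | some x =>
    have hx := List.mem_of_getElem? h
    rw [Multiset.mem_sort, Multiset.mem_map] at hx
    obtain ⟨k, -, rfl⟩ := hx
    exact hf k

lemma eq_of_forall_pos_le_iff {x y : ℝ} (hx : 0 ≤ x) (hy : 0 ≤ y)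
    (h : ∀ t, 0 < t → (t ≤ x ↔ t ≤ y)) : x = y := by
  apply le_antisymm
  · rcases hx.eq_or_lt with h0 | h0
    · rwa [← h0]
    · exact (h x h0).1 le_rfl
  · rcases hy.eq_or_lt with h0 | h0
    · rwa [← h0]
    · exact (h y h0).2 le_rfl

lemma bMax_le (hb : 0 < b) (p : ι → Prop) [DecidablePred p] (ht : 0 ≤ t)
    (hp : #{k ∈ s | p k} < b) (h : ∀ k ∈ s, ¬ p k → f k ≤ t) : bMax b s f ≤ t := by
  by_contra hlt
  push Not at hlt
  have h1 := (le_bMax_iff hb (ht.trans_lt hlt)).1 (le_refl (bMax b s f))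
  have h2 : #{k ∈ s | bMax b s f ≤ f k} ≤ #{k ∈ s | p k} := by
    apply card_le_card
    intro k hk
    rw [mem_filter] at hk ⊢
    refine ⟨hk.1, ?_⟩
    by_contra hpk
    linarith [h k hk.1 hpk]
  omega

lemma le_bMax (hb : 0 < b) (p : ι → Prop) [DecidablePred p] (hf : ∀ k, 0 ≤ f k)
    (hp : b ≤ #{k ∈ s | p k}) (h : ∀ k ∈ s, p k → t ≤ f k) : t ≤ bMax b s f := by
  rcases le_or_gt t 0 with ht | ht
  · exact ht.trans (bMax_nonneg hf)
  · rw [le_bMax_iff hb ht]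
    refine hp.trans (card_le_card fun k hk => ?_)
    rw [mem_filter] at hk ⊢
    exact ⟨hk.1, h k hk.1 hk.2⟩

/-- Fewer than `b` entries, all at the top, may be raised freely. If `b` raised entries reach `t`,
one of them is an unraised entry, and the top entries already dominated it. -/
lemma bMax_congr (hb : 0 < b) (p : ι → Prop) [DecidablePred p] (hf : ∀ k, 0 ≤ f k)
    (hle : ∀ k ∈ s, f k ≤ f' k) (hf' : ∀ k, 0 ≤ f' k) (hp : #{k ∈ s | p k} < b)
    (heq : ∀ k ∈ s, ¬ p k → f k = f' k)
    (hdom : ∀ k ∈ s, ∀ l ∈ s, p k → ¬ p l → f l ≤ f k) : bMax b s f = bMax b s f' := by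
  refine eq_of_forall_pos_le_iff (bMax_nonneg hf) (bMax_nonneg hf') fun t ht => ?_
  rw [le_bMax_iff hb ht, le_bMax_iff hb ht]
  constructor
  · refine fun h => h.trans (card_le_card fun k hk => ?_)
    rw [mem_filter] at hk ⊢
    exact ⟨hk.1, hk.2.trans (hle k hk.1)⟩
  · intro h
    obtain ⟨l, hl, hpl⟩ : ∃ l ∈ ({k ∈ s | t ≤ f' k} : Finset ι), ¬ p l := by
      by_contra! hcon
      have : #{k ∈ s | t ≤ f' k} ≤ #{k ∈ s | p k} :=
        card_le_card fun k hk => mem_filter.2 ⟨(mem_filter.1 hk).1, hcon k hk⟩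
      omega
    rw [mem_filter] at hl
    refine h.trans (card_le_card fun k hk => ?_)
    rw [mem_filter] at hk ⊢
    refine ⟨hk.1, ?_⟩
    by_cases hpk : p k
    · exact (hl.2.trans_eq (heq l hl.1 hpl).symm).trans (hdom k hk.1 l hl.1 hpk hpl)
    · rw [heq k hk.1 hpk]; exact hk.2

variable [DecidableEq ι] {d e : ι}

lemma card_filter_le_erase_add_one (hd : d ∈ s) (h : t ≤ f d) :
    #{k ∈ s.erase d | t ≤ f k} + 1 = #{k ∈ s | t ≤ f k} := by
  rw [filter_erase, card_erase_add_one]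
  exact mem_filter.2 ⟨hd, h⟩

lemma filter_erase_of_lt (h : f d < t) :
    ({k ∈ s.erase d | t ≤ f k} : Finset ι) = {k ∈ s | t ≤ f k} := by
  rw [filter_erase, erase_eq_of_notMem]
  simp [h]

lemma bMax_eq_bMax_erase (hb : 0 < b) (hf : ∀ k, 0 ≤ f k) (hd : d ∈ s)
    (h : f d ≤ bMax b (s.erase d) f) : bMax b s f = bMax b (s.erase d) f := by
  refine eq_of_forall_pos_le_iff (bMax_nonneg hf) (bMax_nonneg hf) fun t ht => ?_
  by_cases htd : t ≤ f d
  · have h1 := htd.trans h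
    have h2 := (le_bMax_iff hb ht).1 h1
    have h3 := card_filter_le_erase_add_one hd htd
    rw [le_bMax_iff hb ht]
    simp only [h1, iff_true]
    omega
  · rw [le_bMax_iff hb ht, le_bMax_iff hb ht, filter_erase_of_lt (not_le.1 htd)]

lemma bMax_le_of_bMax_erase_lt (hb : 0 < b) (hf : ∀ k, 0 ≤ f k)
    (h : bMax b (s.erase d) f < f d) : bMax b s f ≤ f d := by
  by_contra hlt
  push Not at hlt
  have hpos := (hf d).trans_lt hlt
  have h1 := (le_bMax_iff hb hpos).1 (le_refl (bMax b s f))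
  rw [← filter_erase_of_lt hlt, ← le_bMax_iff hb hpos] at h1
  linarith

lemma lt_of_bMax_erase_lt_of_le (hb : 0 < b) (hf : ∀ k, 0 ≤ f k) (hd : d ∈ s) (he : e ∈ s)
    (h : bMax b (s.erase d) f < f d) (h' : f e ≤ bMax b (s.erase e) f) : f e < f d := by
  by_contra! hle
  have hpos : 0 < f d := (bMax_nonneg hf).trans_lt h
  have h1 := (le_bMax_iff hb (hpos.trans_le hle)).1 h'
  have h2 := card_filter_le_erase_add_one (s := s) he (le_refl (f e))
  have h3 := card_filter_le_erase_add_one (s := s) hd (le_refl (f d))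
  have h4 : #{k ∈ s | f e ≤ f k} ≤ #{k ∈ s | f d ≤ f k} :=
    card_le_card fun k hk => mem_filter.2 ⟨(mem_filter.1 hk).1, hle.trans (mem_filter.1 hk).2⟩
  exact absurd h (not_lt.2 ((le_bMax_iff hb hpos).2 (by omega)))

/-- With more than `b` such entries, the smallest of them would have `b` others at least as large.
-/
lemma card_bMax_erase_lt_le (hb : 0 < b) (hf : ∀ k, 0 ≤ f k) :
    #{d ∈ s | bMax b (s.erase d) f < f d} ≤ b := by
  by_contra! hlt
  obtain ⟨d, hd, hmin⟩ := exists_min_image _ f (card_pos.1 (hb.trans hlt))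
  rw [mem_filter] at hd
  have h1 := card_filter_le_erase_add_one (s := s) hd.1 (le_refl (f d))
  have h2 : #{d ∈ s | bMax b (s.erase d) f < f d} ≤ #{k ∈ s | f d ≤ f k} :=
    card_le_card fun k hk => mem_filter.2 ⟨(mem_filter.1 hk).1, hmin k hk⟩
  exact absurd hd.2 (not_lt.2 ((le_bMax_iff hb ((bMax_nonneg hf).trans_lt hd.2)).2 (by omega)))

lemma card_bMax_erase_lt_lt (hb : 0 < b) (hf : ∀ k, 0 ≤ f k) (he : e ∈ s)
    (h : f e = bMax b (s.erase e) f) : #{d ∈ s | bMax b (s.erase d) f < f d} < b := by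
  by_contra! hle
  obtain ⟨d, hd, hmin⟩ := exists_min_image _ f (card_pos.1 (hb.trans_le hle))
  have hd' := mem_filter.1 hd
  have h1 := lt_of_bMax_erase_lt_of_le hb hf hd'.1 he hd'.2 h.le
  have h2 : f d ≤ bMax b s f :=
    le_bMax hb (fun d => bMax b (s.erase d) f < f d) hf hle fun k hk hpk =>
      hmin k (mem_filter.2 ⟨hk, hpk⟩)
  rw [bMax_eq_bMax_erase hb hf he h.le, ← h] at h2
  linarith

end bMax

/-! ### Sums over edges and arcs -/

section LP

open scoped Classical

variable {V : Type*} {N : BargainingNetwork V}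

lemma edge_symm (d : N.Arc) : edge d.symm = edge d := Subtype.ext d.edge_symm

lemma exists_edge_eq (e : N.graph.edgeSet) : ∃ d : N.Arc, edge d = e := by
  obtain ⟨e, he⟩ := e
  induction e using Sym2.ind with
  | _ v w => exact ⟨⟨(v, w), he⟩, rfl⟩

lemma mem_edge {i : V} {d : N.Arc} : i ∈ (edge d : Sym2 V) ↔ i = d.fst ∨ i = d.snd := by
  have : (edge d : Sym2 V) = s(d.fst, d.snd) := rfl
  rw [this, Sym2.mem_iff]

lemma edgeIndicator_injective : Function.Injective N.edgeIndicator := by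
  intro M M' h
  ext e
  have := congrFun h e
  simp only [edgeIndicator] at this
  by_cases h1 : e ∈ M <;> by_cases h2 : e ∈ M' <;> simp_all

lemma degreeIn_eq_card_filter (M : Finset N.graph.edgeSet) (i : V) :
    N.degreeIn M i = #(M.filter fun e : N.graph.edgeSet => i ∈ (e : Sym2 V)) := by
  -- In `degreeIn` the filter is over `Sym2 V`, with `M` coerced there by a monadic bind; this bind
  -- is an injective image.
  have h : (M >>= fun a => (pure (a : Sym2 V) : Finset (Sym2 V))) = M.image Subtype.val := by
    ext e
    simp [bind_def, eq_comm]
  rw [degreeIn, h, filter_image, card_image_of_injective _ Subtype.val_injective]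

/-- `1` on the arcs of non-matching edges, `-1` on the arcs of matching edges. -/
noncomputable def sign (M : Finset N.graph.edgeSet) (a : N.Arc) : ℝ := if edge a ∈ M then -1 else 1

/-- The signed number of arcs in `C` over each edge. -/
noncomputable def alternatingVector (M : Finset N.graph.edgeSet) (C : Finset N.Arc) : N.graph.edgeSet → ℝ :=
  fun e => ∑ a ∈ C, if edge a = e then sign M a else 0

lemma alternatingVector_eq {M : Finset N.graph.edgeSet} (C : Finset N.Arc) (e : N.graph.edgeSet) :
    alternatingVector M C e = if e ∈ M then -(#{a ∈ C | edge a = e} : ℝ)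
      else (#{a ∈ C | edge a = e} : ℝ) := by
  have h : ∀ a ∈ C, (if edge a = e then sign M a else 0)
      = (if e ∈ M then -1 else 1) * (if edge a = e then 1 else 0) := by
    intro a _
    by_cases h : edge a = e
    · subst h; simp [sign]
    · simp [h]
  rw [alternatingVector, sum_congr rfl h, ← mul_sum, sum_boole]
  split_ifs <;> simp

variable [Fintype V]

lemma mem_incoming {i : V} {d : N.Arc} : d ∈ N.incoming i ↔ d.snd = i := by
  simp [incoming]

lemma edge_injOn_incoming (i : V) : Set.InjOn edge (N.incoming i : Set N.Arc) := by
  intro d hd e he h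
  rw [mem_coe, mem_incoming] at hd he
  have h' : d.edge = e.edge := congrArg Subtype.val h
  rcases SimpleGraph.dart_edge_eq_iff d e |>.1 h' with h | h
  · exact h
  · exfalso
    apply e.adj.ne
    have : d.snd = e.fst := by rw [h]; rfl
    rw [← this, hd, he]

lemma image_edge_incoming (i : V) :
    (N.incoming i).image edge = ({e | i ∈ (e : Sym2 V)} : Finset N.graph.edgeSet) := by
  ext e
  simp only [mem_image, mem_filter, mem_univ, true_and]
  constructor
  · rintro ⟨d, hd, rfl⟩
    exact mem_edge.2 (Or.inr (mem_incoming.1 hd).symm)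
  · intro h
    obtain ⟨d, rfl⟩ := exists_edge_eq e
    rcases mem_edge.1 h with h | h
    · exact ⟨d.symm, mem_incoming.2 h.symm, edge_symm d⟩
    · exact ⟨d, mem_incoming.2 h.symm, rfl⟩

lemma degreeIn_eq_card (M : Finset N.graph.edgeSet) (i : V) :
    N.degreeIn M i = #{d ∈ N.incoming i | edge d ∈ M} := by
  have h : (M.filter fun e : N.graph.edgeSet => i ∈ (e : Sym2 V))
      = ({d ∈ N.incoming i | edge d ∈ M} : Finset N.Arc).image edge := by
    ext e
    have := Finset.ext_iff.1 (image_edge_incoming (N := N) i) e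
    simp only [mem_image, mem_filter, mem_univ, true_and] at this ⊢
    rw [← this]
    constructor
    · rintro ⟨h1, d, h2, rfl⟩
      exact ⟨d, ⟨h2, h1⟩, rfl⟩
    · rintro ⟨d, ⟨h2, h1⟩, rfl⟩
      exact ⟨h1, d, h2, rfl⟩
  rw [degreeIn_eq_card_filter, h, card_image_of_injOn]
  exact (edge_injOn_incoming i).mono (coe_subset.2 (filter_subset _ _))

lemma sum_edgeIndicator (M : Finset N.graph.edgeSet) (i : V) :
    ∑ e ∈ univ.filter (fun e : N.graph.edgeSet => i ∈ (e : Sym2 V)), N.edgeIndicator M e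
      = N.degreeIn M i := by
  simp only [edgeIndicator, degreeIn_eq_card_filter]
  rw [Finset.sum_boole, filter_filter]
  refine congrArg (fun F : Finset N.graph.edgeSet => (#F : ℝ)) ?_
  ext e
  simp [and_comm]

/-- The sum of the dual variables at the two ends of an edge. -/
noncomputable def endSum (y : V → ℝ) (e : N.graph.edgeSet) : ℝ := ∑ i, if i ∈ (e : Sym2 V) then y i else 0

lemma endSum_edge (y : V → ℝ) (d : N.Arc) : endSum y (edge d) = y d.fst + y d.snd := by
  have h : ∀ i, (if i ∈ (edge d : Sym2 V) then y i else 0)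
      = (if i = d.fst then y i else 0) + (if i = d.snd then y i else 0) := by
    intro i
    have := d.adj.ne
    by_cases h1 : i = d.fst <;> by_cases h2 : i = d.snd <;> simp_all [mem_edge]
  simp [endSum, h, sum_add_distrib]

/-- The objective in terms of dual variables and reduced costs. -/
lemma lpValue_eq (y : V → ℝ) (x : N.graph.edgeSet → ℝ) :
    N.lpValue x =
      ∑ i, y i * ∑ e ∈ univ.filter (fun e : N.graph.edgeSet => i ∈ (e : Sym2 V)), x e
        + ∑ e, x e * (N.weight e - endSum y e) := by
  have h : ∑ i, y i * ∑ e ∈ univ.filter (fun e : N.graph.edgeSet => i ∈ (e : Sym2 V)), x e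
      = ∑ e, x e * endSum y e := by
    simp only [endSum, mul_sum, sum_filter]
    rw [sum_comm]
    refine sum_congr rfl fun e _ => sum_congr rfl fun i _ => ?_
    split_ifs <;> ring
  rw [h, ← sum_add_distrib, lpValue]
  exact sum_congr rfl fun e _ => by ring

lemma lpValue_add_mul (x z : N.graph.edgeSet → ℝ) (c : ℝ) :
    N.lpValue (fun e => x e + c * z e) = N.lpValue x + c * N.lpValue z := by
  simp only [lpValue, mul_sum, ← sum_add_distrib]
  exact sum_congr rfl fun e _ => by ring

lemma isLPFeasible_edgeIndicator {M : Finset N.graph.edgeSet} :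
    N.IsLPFeasible (N.edgeIndicator M) ↔ N.IsBMatching M := by
  constructor
  · intro h i
    have := h.1 i
    rw [sum_edgeIndicator] at this
    exact_mod_cast this
  · refine fun h => ⟨fun i => ?_, fun e => ?_⟩
    · rw [sum_edgeIndicator]
      exact_mod_cast h i
    · unfold edgeIndicator
      split_ifs <;> norm_num

/-- Complementary slackness: a matching that satisfies it with a dual solution is an optimum. -/
lemma isLPOptimum_of_dual {M : Finset N.graph.edgeSet} (hM : N.IsBMatching M) {y : V → ℝ}
    (hy : ∀ i, 0 ≤ y i) (hsat : ∀ i, y i ≠ 0 → N.degreeIn M i = N.cap i)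
    (hin : ∀ d : N.Arc, edge d ∈ M → y d.fst + y d.snd ≤ N.weight (edge d))
    (hout : ∀ d : N.Arc, edge d ∉ M → N.weight (edge d) ≤ y d.fst + y d.snd) :
    N.IsLPOptimum (N.edgeIndicator M) := by
  refine ⟨isLPFeasible_edgeIndicator.2 hM, fun x hx => ?_⟩
  rw [lpValue_eq y x, lpValue_eq y (N.edgeIndicator M)]
  refine add_le_add (sum_le_sum fun i _ => ?_) (sum_le_sum fun e _ => ?_)
  · by_cases h : y i = 0
    · simp [h]
    · rw [sum_edgeIndicator, hsat i h]
      exact mul_le_mul_of_nonneg_left (hx.1 i) (hy i)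
  · obtain ⟨d, rfl⟩ := exists_edge_eq e
    rw [endSum_edge]
    have h0 := hx.2 (edge d)
    by_cases h : edge d ∈ M
    · have := hin d h
      simp only [edgeIndicator, h, if_true]
      nlinarith
    · have := hout d h
      simp only [edgeIndicator, h, if_false]
      nlinarith

/-! ### Alternating walks -/

lemma exists_mem_periodicPts {A : Type*} [Finite A] [Nonempty A] (F : A → A) :
    ∃ a, a ∈ Function.periodicPts F := by
  obtain ⟨a⟩ := ‹Nonempty A›
  obtain ⟨m, n, hmn, h⟩ := Finite.exists_ne_map_eq_of_infinite fun n : ℕ => F^[n] a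
  wlog hlt : m < n generalizing m n
  · exact this n m hmn.symm h.symm (by omega)
  refine ⟨F^[m] a, n - m, by omega, ?_⟩
  change F^[n - m] (F^[m] a) = F^[m] a
  rw [← Function.iterate_add_apply, Nat.sub_add_cancel hlt.le]
  exact h.symm

variable {M : Finset N.graph.edgeSet}

lemma sum_alternatingVector (C : Finset N.Arc) (i : V) :
    ∑ e ∈ univ.filter (fun e : N.graph.edgeSet => i ∈ (e : Sym2 V)), alternatingVector M C e
      = ∑ a ∈ C, (if a.fst = i then sign M a else 0)
        + ∑ a ∈ C, (if a.snd = i then sign M a else 0) := by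
  simp only [alternatingVector]
  rw [sum_comm, ← sum_add_distrib]
  refine sum_congr rfl fun a _ => ?_
  rw [sum_ite_eq]
  have := a.adj.ne
  by_cases h1 : a.fst = i <;> by_cases h2 : a.snd = i <;>
    simp_all [mem_edge, eq_comm]

/-- Each arc leaving `i` is the successor of a unique arc entering `i`, so tail contributions can be
charged to heads. -/
lemma sum_alternatingVector_of_bijOn {C : Finset N.Arc} {F : N.Arc → N.Arc}
    (hF : Set.BijOn F C C) (htail : ∀ a ∈ C, (F a).fst = a.snd) (i : V) :
    ∑ e ∈ univ.filter (fun e : N.graph.edgeSet => i ∈ (e : Sym2 V)), alternatingVector M C e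
      = ∑ a ∈ C, (if a.snd = i then sign M (F a) + sign M a else 0) := by
  rw [sum_alternatingVector]
  have h : ∑ a ∈ C, (if a.fst = i then sign M a else 0)
      = ∑ a ∈ C, (if a.snd = i then sign M (F a) else 0) := by
    symm
    refine sum_bij (fun a _ => F a) (fun a ha => hF.mapsTo ha)
      (fun a ha b hb h => hF.injOn ha hb h)
      (fun b hb => ?_) (fun a ha => by rw [htail a ha])
    obtain ⟨a, ha, rfl⟩ := hF.surjOn hb
    exact ⟨a, ha, rfl⟩
  rw [h, ← sum_add_distrib]
  exact sum_congr rfl fun a _ => by split_ifs <;> simp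

/-- If the LP has the unique optimum `M`, no nonempty set of arcs carries alternating walks that
only stop where this is feasible and free of charge. -/
lemma eq_empty_of_alternating
    (hM : ∀ x : N.graph.edgeSet → ℝ, N.IsLPOptimum x ↔ x = N.edgeIndicator M)
    {y : V → ℝ} (hy : ∀ i, 0 ≤ y i) (A : Set N.Arc)
    (hsymm : ∀ a ∈ A, a.symm ∈ A)
    (hin : ∀ a ∈ A, edge a ∈ M → N.weight (edge a) ≤ y a.fst + y a.snd)
    (hout : ∀ a ∈ A, edge a ∉ M → y a.fst + y a.snd ≤ N.weight (edge a))
    (hplus : ∀ a ∈ A, edge a ∉ M →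
      N.degreeIn M a.snd < N.cap a.snd ∨ ∃ c ∈ A, c.fst = a.snd ∧ edge c ∈ M)
    (hminus : ∀ a ∈ A, edge a ∈ M →
      y a.snd = 0 ∨ ∃ c ∈ A, c.fst = a.snd ∧ edge c ∉ M) : A = ∅ := by
  by_contra hne
  obtain ⟨a₀, ha₀⟩ := Set.nonempty_iff_ne_empty.2 hne
  -- Continue along an arc of the opposite type, or else turn back along the same edge. Turning back
  -- repeats the sign, so the vertex sum changes by `2` at spare capacity or by `-2` where `y`
  -- vanishes.
  have hsucc : ∀ a : N.Arc, ∃ c : N.Arc, (a ∈ A → c ∈ A) ∧ c.fst = a.snd ∧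
      (a ∈ A → sign M c + sign M a = 0 ∨
        (sign M c + sign M a = 2 ∧ N.degreeIn M a.snd < N.cap a.snd) ∨
        (sign M c + sign M a = -2 ∧ y a.snd = 0)) := by
    intro a
    by_cases ha : a ∈ A
    · by_cases haM : edge a ∈ M
      · rcases hminus a ha haM with h | ⟨c, hc, h1, h2⟩
        · refine ⟨a.symm, fun _ => hsymm a ha, rfl, fun _ => Or.inr (Or.inr ⟨?_, h⟩)⟩
          simp only [sign, edge_symm, haM, if_true]; norm_num
        · refine ⟨c, fun _ => hc, h1, fun _ => Or.inl ?_⟩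
          simp [sign, haM, h2]
      · rcases hplus a ha haM with h | ⟨c, hc, h1, h2⟩
        · refine ⟨a.symm, fun _ => hsymm a ha, rfl, fun _ => Or.inr (Or.inl ⟨?_, h⟩)⟩
          simp only [sign, edge_symm, haM, if_false]; norm_num
        · refine ⟨c, fun _ => hc, h1, fun _ => Or.inl ?_⟩
          simp [sign, haM, h2]
    · exact ⟨a.symm, fun h => absurd h ha, rfl, fun h => absurd h ha⟩
  choose F hFA hFtail hFsign using hsucc
  let G : A → A := fun a => ⟨F a, hFA a a.2⟩
  have : Nonempty A := ⟨⟨a₀, ha₀⟩⟩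
  -- The successor map permutes its periodic points, so no simple path or cycle has to be extracted;
  -- an edge may be used in both directions.
  let C : Finset N.Arc := univ.filter fun a => ∃ h : a ∈ A, (⟨a, h⟩ : A) ∈ Function.periodicPts G
  have hC : ∀ {a}, a ∈ C ↔ ∃ h : a ∈ A, (⟨a, h⟩ : A) ∈ Function.periodicPts G := by
    intro a; simp [C]
  have hCA : ∀ a ∈ C, a ∈ A := fun a ha => (hC.1 ha).1
  have hbij : Set.BijOn F C C := by
    have hG := Function.bijOn_periodicPts G
    refine ⟨fun a ha => ?_, fun a ha c hc h => ?_, fun a ha => ?_⟩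
    · obtain ⟨h1, h2⟩ := hC.1 ha
      exact hC.2 ⟨hFA a h1, hG.mapsTo h2⟩
    · obtain ⟨h1, h2⟩ := hC.1 ha
      obtain ⟨h3, h4⟩ := hC.1 hc
      exact congrArg Subtype.val (hG.injOn h2 h4 (Subtype.ext h))
    · obtain ⟨h1, h2⟩ := hC.1 ha
      obtain ⟨⟨c, hc⟩, h3, h4⟩ := hG.surjOn h2
      exact ⟨c, hC.2 ⟨hc, h3⟩, congrArg Subtype.val h4⟩
  obtain ⟨⟨c, hcA⟩, hc⟩ := exists_mem_periodicPts G
  have hcC : c ∈ C := hC.2 ⟨hcA, hc⟩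
  set z := alternatingVector M C with hz
  have hsum := sum_alternatingVector_of_bijOn (M := M) hbij (fun a _ => hFtail a)
  have hcard : ∀ e : N.graph.edgeSet, (#{a ∈ C | edge a = e} : ℝ) ≤ #C := fun e => by
    exact_mod_cast card_filter_le _ _
  -- the objective does not decrease along `z`
  have hval : 0 ≤ N.lpValue z := by
    rw [lpValue_eq y]
    refine add_nonneg (sum_nonneg fun i _ => ?_) (sum_nonneg fun e _ => ?_)
    · rw [hz, hsum, mul_sum]
      refine sum_nonneg fun a ha => ?_
      split_ifs with hi
      · subst hi
        rcases hFsign a (hCA a ha) with h | ⟨h, -⟩ | ⟨-, h⟩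
        · simp [h]
        · rw [h]; linarith [hy a.snd]
        · simp [h]
      · simp
    · rw [hz, alternatingVector_eq]
      rcases (filter (fun a => edge a = e) C).eq_empty_or_nonempty with h0 | ⟨a, ha⟩
      · simp [h0]
      · obtain ⟨haC, rfl⟩ := mem_filter.1 ha
        rw [endSum_edge]
        have h0 : (0 : ℝ) ≤ #{a' ∈ C | edge a' = edge a} := Nat.cast_nonneg _
        split_ifs with h
        · nlinarith [hin a (hCA a haC) h]
        · nlinarith [hout a (hCA a haC) h]
  have hfeas := ((hM _).2 rfl).1
  -- A vertex sum of `z` is at most `2 * #C`, which one unit of spare capacity must absorb; the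
  -- entries of `z` are at most `#C` in absolute value.
  set ε : ℝ := 1 / (2 * #C + 1) with hε
  have hε0 : 0 < ε := by positivity
  have hε1 : ε * (2 * #C) ≤ 1 := by
    rw [hε, div_mul_eq_mul_div, div_le_one (by positivity)]; linarith
  have hopt : N.IsLPOptimum fun e => N.edgeIndicator M e + ε * z e := by
    refine ⟨⟨fun i => ?_, fun e => ?_⟩, fun x hx => ?_⟩
    · rw [sum_add_distrib, ← mul_sum, sum_edgeIndicator, hz, hsum]
      have hdeg := isLPFeasible_edgeIndicator.1 hfeas i
      rcases hdeg.lt_or_eq with h | h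
      · have h1 : ∑ a ∈ C, (if a.snd = i then sign M (F a) + sign M a else 0) ≤ 2 * #C := by
          rw [mul_comm, ← nsmul_eq_mul]
          refine sum_le_card_nsmul _ _ _ fun a _ => ?_
          have : ∀ a, sign M a ≤ 1 := fun a => by unfold sign; split_ifs <;> norm_num
          split_ifs
          · linarith [this a, this (F a)]
          · norm_num
        have h2 : ((N.degreeIn M i : ℕ) : ℝ) + 1 ≤ N.cap i := by exact_mod_cast h
        nlinarith
      · have h1 : ∑ a ∈ C, (if a.snd = i then sign M (F a) + sign M a else 0) ≤ 0 := by
          refine sum_nonpos fun a ha => ?_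
          split_ifs with hi
          · subst hi
            rcases hFsign a (hCA a ha) with h' | ⟨-, h'⟩ | ⟨h', -⟩
            · rw [h']
            · omega
            · rw [h']; norm_num
          · exact le_rfl
        rw [h]
        nlinarith
    · have h0 : (0 : ℝ) ≤ #{a ∈ C | edge a = e} := Nat.cast_nonneg _
      have h1 := hcard e
      have h2 : ε * #{a ∈ C | edge a = e} ≤ 1 := by nlinarith
      have h3 : 0 ≤ ε * #{a ∈ C | edge a = e} := by positivity
      simp only [hz]
      rw [alternatingVector_eq]
      unfold edgeIndicator
      split_ifs <;> constructor <;> linarith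
    · rw [lpValue_add_mul]
      have := ((hM _).2 rfl).2 x hx
      nlinarith
  -- Uniqueness forces `z = 0`, but all arcs over one edge carry the same sign, so nothing cancels
  -- over the edge of `c`.
  have h1 := congrFun ((hM _).1 hopt) (edge c)
  have h2 : z (edge c) = 0 := by
    have : ε * z (edge c) = 0 := by linarith
    exact (mul_eq_zero.1 this).resolve_left hε0.ne'
  have h3 : (0 : ℝ) < #{a ∈ C | edge a = edge c} := by
    exact Nat.cast_pos.2 (card_pos.2 ⟨c, mem_filter.2 ⟨hcC, rfl⟩⟩)
  rw [hz, alternatingVector_eq] at h2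
  split_ifs at h2 <;> linarith

end LP

section Dynamics

open scoped Classical

variable {V : Type*} {N : BargainingNetwork V}

/-! ### Offers -/

/-- The surplus `w_{ij} - α_{i → j} - α_{j → i}` of an edge. -/
def slack (N : BargainingNetwork V) (α : N.Arc → ℝ) (d : N.Arc) : ℝ :=
  N.weight (edge d) - α d - α d.symm

variable {α : N.Arc → ℝ} {d : N.Arc}

lemma slack_symm : N.slack α d.symm = N.slack α d := by
  simp only [slack, edge_symm, SimpleGraph.Dart.symm_symm]
  ring

lemma offer_of_slack_nonneg (hα : ∀ d, 0 ≤ α d) (h : 0 ≤ N.slack α d) :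
    N.offer α d = α d.symm + N.slack α d / 2 := by
  have h1 := hα d.symm
  simp only [slack, offer] at *
  rw [max_eq_left h, max_eq_left (by linarith)]
  ring

lemma offer_of_slack_nonpos (h : N.slack α d ≤ 0) :
    N.offer α d = max (N.weight (edge d) - α d) 0 := by
  simp only [slack, offer] at *
  rw [max_eq_right h]
  ring

lemma offer_nonneg (hα : ∀ d, 0 ≤ α d) (d : N.Arc) : 0 ≤ N.offer α d := by
  rcases le_total 0 (N.slack α d) with h | h
  · rw [offer_of_slack_nonneg hα h]
    linarith [hα d.symm]
  · rw [offer_of_slack_nonpos h]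
    exact le_max_right _ _

lemma offer_le_of_slack_nonpos (hα : ∀ d, 0 ≤ α d) (h : N.slack α d ≤ 0) :
    N.offer α d ≤ α d.symm := by
  rw [offer_of_slack_nonpos h]
  unfold slack at h
  exact max_le (by linarith) (hα _)

/-- At an equilibrium `α d.symm` is the `b`-max of the competing offers, so this turns the sign of
the surplus into a ranking of offers. -/
lemma slack_pos_iff (hα : ∀ d, 0 ≤ α d) : 0 < N.slack α d ↔ α d.symm < N.offer α d := by
  constructor
  · intro h
    rw [offer_of_slack_nonneg hα h.le]
    linarith
  · intro h
    by_contra! hle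
    linarith [offer_le_of_slack_nonpos hα hle]

lemma slack_nonneg_of_le_offer (hpos : 0 < N.offer α d)
    (h : α d.symm ≤ N.offer α d) : 0 ≤ N.slack α d := by
  by_contra! hlt
  rw [offer_of_slack_nonpos hlt.le] at h hpos
  unfold slack at hlt
  rcases le_total (N.weight (edge d) - α d) 0 with h' | h'
  · rw [max_eq_right h'] at hpos
    exact lt_irrefl _ hpos
  · rw [max_eq_left h'] at h
    linarith

lemma offer_add_offer_symm (hα : ∀ d, 0 ≤ α d) (h : 0 ≤ N.slack α d) :
    N.offer α d + N.offer α d.symm = N.weight (edge d) := by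
  rw [offer_of_slack_nonneg hα h, offer_of_slack_nonneg hα (slack_symm.symm ▸ h), slack_symm,
    SimpleGraph.Dart.symm_symm]
  unfold slack
  ring

variable [Fintype V] {M : Finset N.graph.edgeSet} {i : V} {Γ : N.Arc → ℝ}

/-! ### Vertices -/

/-- The `b_i`-th largest of all offers to `i`. -/
noncomputable def thresholdAt (N : BargainingNetwork V) (m : N.Arc → ℝ) (i : V) : ℝ :=
  bMax (N.cap i) (N.incoming i) m

lemma cap_le_card {m : N.Arc → ℝ} (hpos : 0 < N.thresholdAt m i) :
    N.cap i ≤ #{d ∈ N.incoming i | N.thresholdAt m i ≤ m d} :=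
  (le_bMax_iff (N.cap_pos i) hpos).1 le_rfl

lemma card_erase_lt_cap (hM : N.IsBMatching M) {d : N.Arc} (hd : edge d ∈ M) :
    #{e ∈ (N.incoming d.snd).erase d | edge e ∈ M} < N.cap d.snd := by
  have h := hM d.snd
  rw [degreeIn_eq_card] at h
  rw [filter_erase]
  exact (card_erase_lt_of_mem (mem_filter.2 ⟨mem_incoming.2 rfl, hd⟩)).trans_le h

lemma bMaxOthers_congr (hM : N.IsBMatching M) {m f : N.Arc → ℝ} (hm : ∀ e, 0 ≤ m e)
    (hle : ∀ e, m e ≤ f e) (heq : ∀ e, edge e ∉ M → m e = f e)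
    (hdom : ∀ d e, d.snd = e.snd → edge d ∈ M → edge e ∉ M → m e ≤ m d)
    {d : N.Arc} (hd : edge d ∈ M) : N.bMaxOthers m d = N.bMaxOthers f d := by
  refine bMax_congr (N.cap_pos _) (fun e => edge e ∈ M) hm (fun e _ => hle e)
    (fun e => (hm e).trans (hle e)) (card_erase_lt_cap hM hd) (fun e _ => heq e) ?_
  intro k hk l hl hkM hlM
  have hk' := mem_incoming.1 (mem_of_mem_erase hk)
  have hl' := mem_incoming.1 (mem_of_mem_erase hl)
  exact hdom k l (hk'.trans hl'.symm) hkM hlM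

/-- The numbers `(w_{ik} - γ_k)_+`. -/
noncomputable def outsideOption (M : Finset N.graph.edgeSet) (Γ : N.Arc → ℝ) (d : N.Arc) : ℝ :=
  max (N.weight (edge d) - N.gain M Γ d.fst) 0

/-- The messages of a Nash bargaining solution. -/
noncomputable def messagesOf (M : Finset N.graph.edgeSet) (Γ : N.Arc → ℝ) (d : N.Arc) : ℝ :=
  if edge d ∈ M then N.bMaxOthers (outsideOption M Γ) d.symm else N.gain M Γ d.fst

/-! ### Fixed points -/

/-- `α` is a non-negative fixed point of the dynamics, without reference to the damping factor. -/
structure IsEquilibrium (N : BargainingNetwork V) (α : N.Arc → ℝ) : Prop where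
  nonneg : ∀ d, 0 ≤ α d
  eq : ∀ d, α d.symm = N.bMaxOthers (N.offer α) d

lemma isFixedPt_update_iff {κ : ℝ} (hκ : 0 < κ) :
    Function.IsFixedPt (N.update κ) α ↔ ∀ d, α d.symm = N.bMaxOthers (N.offer α) d := by
  constructor
  · intro h d
    have h1 := congrFun h d.symm
    simp only [update, SimpleGraph.Dart.symm_symm] at h1
    have h2 : κ * (α d.symm - N.bMaxOthers (N.offer α) d) = 0 := by linarith
    linarith [(mul_eq_zero.1 h2).resolve_left hκ.ne']
  · intro h
    funext d
    have := h d.symm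
    simp only [update, ← this, SimpleGraph.Dart.symm_symm]
    ring

/-! ### Thresholds and surplus signs at an equilibrium. -/

namespace IsEquilibrium

variable (h : N.IsEquilibrium α)
include h

lemma bMax_erase (hd : d.snd = i) :
    bMax (N.cap i) ((N.incoming i).erase d) (N.offer α) = α d.symm := by
  subst hd
  exact (h.eq d).symm

lemma threshold_nonneg (i : V) : 0 ≤ N.thresholdAt (N.offer α) i :=
  bMax_nonneg (offer_nonneg h.nonneg)

/-- An offer not exceeding the `b`-max of the others does not change the `b`-max when included. -/
lemma threshold_eq (hd : N.slack α d ≤ 0) : N.thresholdAt (N.offer α) d.snd = α d.symm := by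
  rw [h.eq d]
  refine bMax_eq_bMax_erase (N.cap_pos _) (offer_nonneg h.nonneg) (mem_incoming.2 rfl) ?_
  rw [h.bMax_erase rfl]
  exact offer_le_of_slack_nonpos h.nonneg hd

lemma threshold_fst_eq (hd : N.slack α d ≤ 0) : N.thresholdAt (N.offer α) d.fst = α d := by
  have := h.threshold_eq (d := d.symm) (slack_symm.trans_le hd)
  rwa [SimpleGraph.Dart.symm_symm] at this

lemma threshold_le_offer (hd : 0 < N.slack α d) :
    N.thresholdAt (N.offer α) d.snd ≤ N.offer α d := by
  refine bMax_le_of_bMax_erase_lt (d := d) (N.cap_pos _) (offer_nonneg h.nonneg) ?_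
  rw [h.bMax_erase rfl]
  exact (slack_pos_iff h.nonneg).1 hd

lemma threshold_fst_le_offer (hd : 0 < N.slack α d) :
    N.thresholdAt (N.offer α) d.fst ≤ N.offer α d.symm :=
  h.threshold_le_offer (d := d.symm) (slack_symm.symm ▸ hd)

lemma slack_nonneg (hpos : 0 < N.thresholdAt (N.offer α) d.snd)
    (hd : N.thresholdAt (N.offer α) d.snd ≤ N.offer α d) : 0 ≤ N.slack α d := by
  by_contra! hlt
  have h1 := h.threshold_eq hlt.le
  exact absurd (slack_nonneg_of_le_offer (hpos.trans_le hd) (h1 ▸ hd)) (not_le.2 hlt)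

lemma filter_slack_pos (i : V) : ({d ∈ N.incoming i | 0 < N.slack α d} : Finset N.Arc) =
    {d ∈ N.incoming i | bMax (N.cap i) ((N.incoming i).erase d) (N.offer α) < N.offer α d} := by
  refine filter_congr fun d hd => ?_
  rw [h.bMax_erase (mem_incoming.1 hd), slack_pos_iff h.nonneg]

lemma card_slack_pos_le (i : V) : #{d ∈ N.incoming i | 0 < N.slack α d} ≤ N.cap i := by
  rw [h.filter_slack_pos]
  exact card_bMax_erase_lt_le (N.cap_pos i) (offer_nonneg h.nonneg)

lemma card_slack_pos_lt (hd : d.snd = i) (h0 : N.slack α d = 0) :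
    #{d ∈ N.incoming i | 0 < N.slack α d} < N.cap i := by
  rw [h.filter_slack_pos]
  refine card_bMax_erase_lt_lt (N.cap_pos i) (offer_nonneg h.nonneg) (mem_incoming.2 hd) ?_
  rw [h.bMax_erase hd, offer_of_slack_nonneg h.nonneg h0.ge, h0]
  ring

/-- The edges of positive surplus are those of the matching, and no edge has surplus `0`. -/
lemma slack_pos_and_neg
    (hM : ∀ x : N.graph.edgeSet → ℝ, N.IsLPOptimum x ↔ x = N.edgeIndicator M) (d : N.Arc) :
    (edge d ∈ M → 0 < N.slack α d) ∧ (edge d ∉ M → N.slack α d < 0) := by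
  have hB : N.IsBMatching M := isLPFeasible_edgeIndicator.1 ((hM _).2 rfl).1
  -- The set consists of the arcs violating the claim, and the thresholds serve as `y`.
  have hA := eq_empty_of_alternating hM h.threshold_nonneg
    {a | (edge a ∉ M ∧ 0 ≤ N.slack α a) ∨ (edge a ∈ M ∧ N.slack α a ≤ 0)}
    (fun a ha => by simpa only [Set.mem_ofPred_eq, edge_symm, slack_symm] using ha)
    ?_ ?_ ?_ ?_
  · rw [Set.eq_empty_iff_forall_notMem] at hA
    refine ⟨fun hd => ?_, fun hd => ?_⟩
    · by_contra! hle
      exact hA d (Or.inr ⟨hd, hle⟩)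
    · by_contra! hle
      exact hA d (Or.inl ⟨hd, hle⟩)
  · rintro a (⟨ha, -⟩ | ⟨-, ha⟩) haM
    · exact absurd haM ha
    · rw [h.threshold_eq ha, h.threshold_fst_eq ha]
      unfold slack at ha
      linarith
  · rintro a (⟨-, ha⟩ | ⟨ha, -⟩) haM
    · rcases ha.eq_or_lt with h0 | h0
      · rw [h.threshold_eq h0.ge, h.threshold_fst_eq h0.ge]
        unfold slack at h0
        linarith
      · have h1 := h.threshold_le_offer h0
        have h2 := h.threshold_fst_le_offer h0
        have h3 := offer_add_offer_symm h.nonneg h0.le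
        linarith
    · exact absurd ha haM
  · rintro a (⟨-, ha⟩ | ⟨ha, -⟩) haM
    -- At a saturated vertex with no violating matching edge, all `b` matching edges have positive
    -- surplus. An extra edge of positive surplus exceeds the bound `b`; one of surplus `0` lowers
    -- that bound below `b`.
    · by_contra! hcon
      obtain ⟨hdeg, hcon⟩ := hcon
      rw [degreeIn_eq_card] at hdeg
      have hsub : ({c ∈ N.incoming a.snd | edge c ∈ M} : Finset N.Arc) ⊆
          {c ∈ N.incoming a.snd | 0 < N.slack α c} := by
        intro c hc
        rw [mem_filter] at hc ⊢
        refine ⟨hc.1, ?_⟩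
        by_contra! hle
        refine hcon c.symm (Or.inr ⟨by rw [edge_symm]; exact hc.2, by rw [slack_symm]; exact hle⟩)
          (mem_incoming.1 hc.1) (by rw [edge_symm]; exact hc.2)
      rcases ha.eq_or_lt with h0 | h0
      · have h1 := h.card_slack_pos_lt (d := a) rfl h0.symm
        have h2 := card_le_card hsub
        omega
      · have h1 := h.card_slack_pos_le a.snd
        have h2 : a ∈ ({c ∈ N.incoming a.snd | edge c ∈ M} : Finset N.Arc) := by
          rw [eq_of_subset_of_card_le hsub (by omega)]
          exact mem_filter.2 ⟨mem_incoming.2 rfl, h0⟩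
        exact haM (mem_filter.1 h2).2
    · exact absurd ha haM
  · rintro a (⟨ha, -⟩ | ⟨-, ha⟩) haM
    · exact absurd haM ha
    -- Otherwise every offer reaching the positive threshold comes from a partner. There are at
    -- least `b` of these, hence they are all the partners, including `a`. But the surplus of `a` is
    -- `≤ 0`, so `b` offers besides that of `a` reach the threshold: `b + 1` partners.
    · by_contra! hcon
      obtain ⟨hne, hcon⟩ := hcon
      have hpos : 0 < N.thresholdAt (N.offer α) a.snd :=
        lt_of_le_of_ne (h.threshold_nonneg _) hne.symm
      have hdeg := hB a.snd
      rw [degreeIn_eq_card] at hdeg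
      have hsub : ({c ∈ N.incoming a.snd |
            N.thresholdAt (N.offer α) a.snd ≤ N.offer α c} : Finset N.Arc) ⊆
          {c ∈ N.incoming a.snd | edge c ∈ M} := by
        intro c hc
        rw [mem_filter] at hc ⊢
        refine ⟨hc.1, ?_⟩
        by_contra hcM
        have hc' := mem_incoming.1 hc.1
        have h1 : 0 ≤ N.slack α c := h.slack_nonneg (hc' ▸ hpos) (hc' ▸ hc.2)
        exact hcM (by
          have := hcon c.symm (Or.inl ⟨by rwa [edge_symm], by rwa [slack_symm]⟩) hc'
          rwa [edge_symm] at this)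
      have hcap := cap_le_card hpos
      have ha' : a ∈ ({c ∈ N.incoming a.snd |
          N.thresholdAt (N.offer α) a.snd ≤ N.offer α c} : Finset N.Arc) := by
        rw [eq_of_subset_of_card_le hsub (by omega)]
        exact mem_filter.2 ⟨mem_incoming.2 rfl, haM⟩
      have hle := (mem_filter.1 ha').2
      have h2 := h.threshold_eq ha
      rw [h.eq a] at h2
      have h3 := (le_bMax_iff (N.cap_pos _) hpos).1 h2.le
      have h4 := card_filter_le_erase_add_one (s := N.incoming a.snd) (mem_incoming.2 rfl) hle
      have h5 := card_le_card hsub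
      omega

/-! ### Consequences of positive surplus on the matching and negative surplus off it. -/

section Matching

variable (hM : N.IsBMatching M) (hin : ∀ d, edge d ∈ M → 0 < N.slack α d)
  (hout : ∀ d, edge d ∉ M → N.slack α d < 0)
include hM hin hout

omit hM hin hout in
lemma offer_lt_of_slack {e : N.Arc} (hde : d.snd = e.snd) (hd : 0 < N.slack α d)
    (he : N.slack α e ≤ 0) : N.offer α e < N.offer α d := by
  refine lt_of_bMax_erase_lt_of_le (N.cap_pos e.snd) (offer_nonneg h.nonneg)
    (mem_incoming.2 hde) (mem_incoming.2 rfl) ?_ ?_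
  · rw [h.bMax_erase hde]
    exact (slack_pos_iff h.nonneg).1 hd
  · rw [h.bMax_erase rfl]
    exact offer_le_of_slack_nonpos h.nonneg he

omit hM in
lemma offer_lt_offer {e : N.Arc} (hde : d.snd = e.snd) (hd : edge d ∈ M) (he : edge e ∉ M) :
    N.offer α e < N.offer α d :=
  h.offer_lt_of_slack hde (hin d hd) (hout e he).le

omit hM hout in
lemma offer_pos (hd : edge d ∈ M) : 0 < N.offer α d :=
  (h.nonneg _).trans_lt ((slack_pos_iff h.nonneg).1 (hin d hd))

omit hM hin in
-- A positive threshold is reached by at least `b_i` offers, each of non-negative surplus and so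
-- from a partner.
lemma threshold_eq_zero (hi : N.degreeIn M i < N.cap i) : N.thresholdAt (N.offer α) i = 0 := by
  by_contra hne
  have hpos := lt_of_le_of_ne (h.threshold_nonneg i) (Ne.symm hne)
  have h1 := cap_le_card hpos
  rw [degreeIn_eq_card] at hi
  have h2 : #{d ∈ N.incoming i | N.thresholdAt (N.offer α) i ≤ N.offer α d} ≤
      #{d ∈ N.incoming i | edge d ∈ M} := by
    refine card_le_card fun c hc => ?_
    rw [mem_filter] at hc ⊢
    refine ⟨hc.1, ?_⟩
    by_contra hcM
    have hc' := mem_incoming.1 hc.1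
    exact absurd (h.slack_nonneg (hc' ▸ hpos) (hc' ▸ hc.2)) (not_le.2 (hout c hcM))
  omega

omit hM hin in
lemma offer_eq_zero (hi : N.degreeIn M d.snd < N.cap d.snd) (hd : edge d ∉ M) :
    N.offer α d = 0 := by
  have h1 := (hout d hd).le
  have h2 := offer_le_of_slack_nonpos h.nonneg h1
  rw [← h.threshold_eq h1, h.threshold_eq_zero hout hi] at h2
  exact le_antisymm h2 (offer_nonneg h.nonneg d)

lemma induces : N.Induces α M := by
  refine ⟨hM, fun i => ⟨fun hi => ⟨?_, ?_⟩, fun hi d hd => ⟨?_, ?_⟩⟩⟩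
  · rw [← degreeIn_eq_card]
    refine (hM i).antisymm ?_
    by_contra! hlt
    have : #{d ∈ N.incoming i | 0 < N.offer α d} ≤ #{d ∈ N.incoming i | edge d ∈ M} := by
      refine card_le_card fun c hc => ?_
      rw [mem_filter] at hc ⊢
      refine ⟨hc.1, ?_⟩
      by_contra hcM
      have hc' := mem_incoming.1 hc.1
      exact hc.2.ne' (h.offer_eq_zero hout (hc'.symm ▸ hlt) hcM)
    rw [degreeIn_eq_card] at hlt
    omega
  · intro d hd e he hdM heM
    exact h.offer_lt_offer hin hout ((mem_incoming.1 hd).trans (mem_incoming.1 he).symm) hdM heM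
  · exact fun hdM => h.offer_pos hin hdM
  · intro hpos
    by_contra hdM
    have hd' := mem_incoming.1 hd
    have hdeg : N.degreeIn M d.snd < N.cap d.snd := by
      rw [hd']
      refine lt_of_le_of_lt ?_ hi
      rw [degreeIn_eq_card]
      refine card_le_card fun c hc => ?_
      rw [mem_filter] at hc ⊢
      exact ⟨hc.1, h.offer_pos hin hc.2⟩
    exact hpos.ne' (h.offer_eq_zero hout hdeg hdM)

lemma eq_of_isTopOffers (hΓ : N.IsTopOffers (N.offer α) Γ) (d : N.Arc) :
    Γ d = if edge d ∈ M then N.offer α d else 0 := by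
  obtain ⟨T, hT, hcard, htop, hval⟩ := hΓ d.snd
  have hdeg := hM d.snd
  have hsub : ({c ∈ N.incoming d.snd | edge c ∈ M} : Finset N.Arc) ⊆ T := by
    intro c hc
    by_contra hcT
    have hc' := mem_filter.1 hc
    -- If a partner `c` is left out of `T`, then `T` contains only partners, so `T` has fewer than
    -- `b` elements and must be all of the incoming arcs.
    have h1 : insert c T ⊆ ({c ∈ N.incoming d.snd | edge c ∈ M} : Finset N.Arc) := by
      refine insert_subset hc fun e he => mem_filter.2 ⟨hT he, ?_⟩
      by_contra heM
      have h2 := htop e he c (mem_sdiff.2 ⟨hc'.1, hcT⟩)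
      have h3 := h.offer_lt_offer hin hout (d := c) (e := e)
        ((mem_incoming.1 hc'.1).trans (mem_incoming.1 (hT he)).symm) hc'.2 heM
      linarith
    have h2 := card_le_card h1
    rw [card_insert_of_notMem hcT, ← degreeIn_eq_card] at h2
    have h3 : T = N.incoming d.snd := eq_of_subset_of_card_le hT (by omega)
    exact hcT (h3 ▸ hc'.1)
  rw [hval d (mem_incoming.2 rfl)]
  by_cases hd : edge d ∈ M
  · rw [if_pos hd, if_pos (hsub (mem_filter.2 ⟨mem_incoming.2 rfl, hd⟩))]
  · rw [if_neg hd]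
    split_ifs with hdT
    · refine h.offer_eq_zero hout ?_ hd
      -- A non-partner fits into `T` only at an unsaturated vertex, where its offer is `0`; hence
      -- ties are harmless.
      have h1 : insert d ({c ∈ N.incoming d.snd | edge c ∈ M} : Finset N.Arc) ⊆ T :=
        insert_subset hdT hsub
      have h2 := card_le_card h1
      rw [card_insert_of_notMem (by simp [hd]), ← degreeIn_eq_card] at h2
      omega
    · rfl

variable (hΓ : N.IsTopOffers (N.offer α) Γ)
include hΓ

lemma isTradeOutcome : N.IsTradeOutcome M Γ := by
  have hval := h.eq_of_isTopOffers hM hin hout hΓ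
  refine ⟨hM, fun d => ?_, fun d hd => ?_, fun d hd => ?_⟩
  · rw [hval]
    split_ifs
    · exact offer_nonneg h.nonneg d
    · exact le_rfl
  · rw [hval, if_neg hd]
  · rw [hval, hval, edge_symm, if_pos hd, if_pos hd, offer_add_offer_symm h.nonneg (hin d hd).le]

lemma gain_eq (i : V) : N.gain M Γ i = N.thresholdAt (N.offer α) i := by
  have hval := h.eq_of_isTopOffers hM hin hout hΓ
  unfold gain
  split_ifs with hi
  · refine IsLeast.csInf_eq ⟨?_, ?_⟩
    · have hdeg := hi
      rw [degreeIn_eq_card] at hdeg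
      obtain ⟨d, hd, hmin⟩ := exists_min_image
        ({d ∈ N.incoming i | edge d ∈ M} : Finset N.Arc) (N.offer α)
        (card_pos.1 (hdeg ▸ N.cap_pos i))
      obtain ⟨hd1, hd2⟩ := mem_filter.1 hd
      have hd1 := mem_incoming.1 hd1
      refine ⟨d, ⟨hd1, hd2⟩, ?_⟩
      rw [hval, if_pos hd2]
      refine le_antisymm ?_ ?_
      · exact le_bMax (N.cap_pos i) (fun d => edge d ∈ M) (offer_nonneg h.nonneg) hdeg.ge
          fun k hk hkM => hmin k (mem_filter.2 ⟨hk, hkM⟩)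
      · exact hd1 ▸ h.threshold_le_offer (hin d hd2)
    · rintro _ ⟨d, ⟨rfl, hd⟩, rfl⟩
      rw [hval, if_pos hd]
      exact h.threshold_le_offer (hin d hd)
  · exact (h.threshold_eq_zero hout ((hM i).lt_of_ne hi)).symm

lemma bMaxOthers_outsideOption (hd : edge d ∈ M) :
    N.bMaxOthers (outsideOption M Γ) d = α d.symm := by
  have hgain := h.gain_eq hM hin hout hΓ
  have heq : ∀ e, edge e ∉ M → N.offer α e = outsideOption M Γ e := by
    intro e he
    rw [outsideOption, hgain, h.threshold_fst_eq (hout e he).le,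
      offer_of_slack_nonpos (hout e he).le]
  rw [h.eq]
  refine (bMaxOthers_congr hM (offer_nonneg h.nonneg) (fun e => ?_) heq
    (fun d e hde hd he => (h.offer_lt_offer hin hout hde hd he).le) hd).symm
  by_cases he : edge e ∈ M
  · refine le_max_of_le_left ?_
    rw [hgain]
    linarith [offer_add_offer_symm h.nonneg (hin e he).le, h.threshold_fst_le_offer (hin e he)]
  · exact (heq e he).le

lemma isNashBargaining : N.IsNashBargaining M Γ := by
  have hval := h.eq_of_isTopOffers hM hin hout hΓ
  have hgain := h.gain_eq hM hin hout hΓ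
  refine ⟨h.isTradeOutcome hM hin hout hΓ, fun d hd => ?_, fun d hd => ?_⟩
  · have h1 := hout d hd
    rw [hgain, hgain, h.threshold_eq h1.le, h.threshold_fst_eq h1.le]
    unfold slack at h1
    linarith
  · have hd' : edge d.symm ∈ M := by rwa [edge_symm]
    have h1 := h.bMaxOthers_outsideOption hM hin hout hΓ hd
    have h2 := h.bMaxOthers_outsideOption hM hin hout hΓ hd'
    unfold outsideOption at h1 h2
    rw [h1, h2, hval, hval, if_pos hd, if_pos hd', offer_of_slack_nonneg h.nonneg (hin d hd).le,
      offer_of_slack_nonneg h.nonneg (hin _ hd').le, slack_symm]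
    ring

/-- This is the uniqueness of the fixed point: the messages depend on `M` and `Γ` alone. -/
lemma eq_messagesOf : α = messagesOf M Γ := by
  funext d
  unfold messagesOf
  split_ifs with hd
  · have := h.bMaxOthers_outsideOption hM hin hout hΓ (d := d.symm) (by rwa [edge_symm])
    rw [this, SimpleGraph.Dart.symm_symm]
  · rw [h.gain_eq hM hin hout hΓ, h.threshold_fst_eq (hout d hd).le]

end Matching

end IsEquilibrium

end Dynamics

section Nash

open scoped Classical

/-! ### Nash bargaining solutions give fixed points -/

variable {V : Type*} {N : BargainingNetwork V} {M : Finset N.graph.edgeSet}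
  {Γ : N.Arc → ℝ} {d : N.Arc} {i : V}

lemma gain_of_ne (hi : N.degreeIn M i ≠ N.cap i) : N.gain M Γ i = 0 := if_neg hi

variable [Fintype V]

lemma exists_gain_eq (hi : N.degreeIn M i = N.cap i) :
    ∃ d : N.Arc, d.snd = i ∧ edge d ∈ M ∧ Γ d = N.gain M Γ i ∧
      ∀ e : N.Arc, e.snd = i → edge e ∈ M → Γ d ≤ Γ e := by
  have hdeg := hi
  rw [degreeIn_eq_card] at hdeg
  obtain ⟨d, hd, hmin⟩ := exists_min_image
    ({d ∈ N.incoming i | edge d ∈ M} : Finset N.Arc) Γ (card_pos.1 (hdeg ▸ N.cap_pos i))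
  obtain ⟨hd1, hd2⟩ := mem_filter.1 hd
  have hmin' : ∀ e : N.Arc, e.snd = i → edge e ∈ M → Γ d ≤ Γ e := fun e he heM =>
    hmin e (mem_filter.2 ⟨mem_incoming.2 he, heM⟩)
  refine ⟨d, mem_incoming.1 hd1, hd2, ?_, hmin'⟩
  rw [gain, if_pos hi]
  symm
  refine IsLeast.csInf_eq ⟨⟨d, ⟨mem_incoming.1 hd1, hd2⟩, rfl⟩, ?_⟩
  rintro _ ⟨e, ⟨he, heM⟩, rfl⟩
  exact hmin' e he heM

namespace IsTradeOutcome

variable (h : N.IsTradeOutcome M Γ)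
include h

lemma gain_nonneg (i : V) : 0 ≤ N.gain M Γ i := by
  by_cases hi : N.degreeIn M i = N.cap i
  · obtain ⟨d, -, -, hd, -⟩ := exists_gain_eq (Γ := Γ) hi
    exact hd ▸ h.2.1 d
  · exact (gain_of_ne hi).ge

lemma gain_le (hd : edge d ∈ M) : N.gain M Γ d.snd ≤ Γ d := by
  by_cases hi : N.degreeIn M d.snd = N.cap d.snd
  · obtain ⟨e, -, -, he, hmin⟩ := exists_gain_eq (Γ := Γ) hi
    exact he ▸ hmin d rfl hd
  · rw [gain_of_ne hi]
    exact h.2.1 d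

lemma gain_fst_le (hd : edge d ∈ M) : N.gain M Γ d.fst ≤ Γ d.symm :=
  h.gain_le (d := d.symm) (by rwa [edge_symm])

/-- The gains are the dual solution: they vanish at unsaturated vertices, sum to at most the weight
on `M`, and stability is dual feasibility off `M`. -/
lemma isLPOptimum (hs : N.IsStable M Γ) : N.IsLPOptimum (N.edgeIndicator M) := by
  refine isLPOptimum_of_dual h.1 h.gain_nonneg (fun i hi => ?_) (fun d hd => ?_) hs
  · by_contra hne
    exact hi (gain_of_ne hne)
  · linarith [h.gain_le hd, h.gain_fst_le hd, h.2.2.2 d hd]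

end IsTradeOutcome

namespace IsNashBargaining

variable (h : N.IsNashBargaining M Γ)
include h

lemma outsideOption_le (hd : edge d ∉ M) : outsideOption M Γ d ≤ N.gain M Γ d.snd :=
  max_le (by linarith [h.2.1 d hd]) (h.1.gain_nonneg _)

lemma bMaxOthers_outsideOption_le (hd : edge d ∈ M) :
    N.bMaxOthers (outsideOption M Γ) d ≤ N.gain M Γ d.snd := by
  refine bMax_le (N.cap_pos _) (fun e => edge e ∈ M) (h.1.gain_nonneg _)
    (card_erase_lt_cap h.1.1 hd) fun k hk hkM => ?_
  have hk' := mem_incoming.1 (mem_of_mem_erase hk)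
  exact hk' ▸ h.outsideOption_le hkM

lemma messagesOf_nonneg (d : N.Arc) : 0 ≤ messagesOf M Γ d := by
  unfold messagesOf
  split_ifs
  · exact bMax_nonneg fun e => le_max_right _ _
  · exact h.1.gain_nonneg _

lemma offer_messagesOf (d : N.Arc) :
    N.offer (messagesOf M Γ) d = if edge d ∈ M then Γ d else outsideOption M Γ d := by
  split_ifs with hd
  · have hd' : edge d.symm ∈ M := by rwa [edge_symm]
    have h1 : messagesOf M Γ d = N.bMaxOthers (outsideOption M Γ) d.symm := if_pos hd
    have h2 : messagesOf M Γ d.symm = N.bMaxOthers (outsideOption M Γ) d := by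
      rw [messagesOf, if_pos hd', SimpleGraph.Dart.symm_symm]
    have h3 := h.2.2 d hd
    change Γ d - N.bMaxOthers (outsideOption M Γ) d
      = Γ d.symm - N.bMaxOthers (outsideOption M Γ) d.symm at h3
    rw [← h1, ← h2] at h3
    have h4 := h.bMaxOthers_outsideOption_le hd
    rw [← h2] at h4
    have h5 := h.1.gain_le hd
    have h6 := h.1.2.2.2 d hd
    -- Balance makes the two excesses over the best alternatives equal, and together they make up
    -- the surplus.
    have h7 : N.slack (messagesOf M Γ) d = 2 * (Γ d - messagesOf M Γ d.symm) := by
      unfold slack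
      linarith
    rw [offer_of_slack_nonneg h.messagesOf_nonneg (by rw [h7]; linarith), h7]
    ring
  · have hd' : edge d.symm ∉ M := by rwa [edge_symm]
    have h1 : messagesOf M Γ d = N.gain M Γ d.fst := if_neg hd
    have h2 : messagesOf M Γ d.symm = N.gain M Γ d.snd := if_neg hd'
    have h3 := h.2.1 d hd
    rw [offer_of_slack_nonpos (by unfold slack; linarith), h1]
    rfl

lemma offer_le_gain (hd : edge d ∉ M) :
    N.offer (messagesOf M Γ) d ≤ N.gain M Γ d.snd := by
  rw [h.offer_messagesOf, if_neg hd]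
  exact h.outsideOption_le hd

lemma gain_le_offer (hd : edge d ∈ M) :
    N.gain M Γ d.snd ≤ N.offer (messagesOf M Γ) d := by
  rw [h.offer_messagesOf, if_pos hd]
  exact h.1.gain_le hd

lemma bMaxOthers_offer_of_notMem (hd : edge d ∉ M) :
    N.bMaxOthers (N.offer (messagesOf M Γ)) d = N.gain M Γ d.snd := by
  have hoff := offer_nonneg (N := N) h.messagesOf_nonneg
  have hB := h.1.1 d.snd
  have hcard : #{e ∈ (N.incoming d.snd).erase d | edge e ∈ M} = N.degreeIn M d.snd := by
    rw [degreeIn_eq_card, filter_erase, erase_eq_of_notMem (by simp [hd])]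
  have hnot : ∀ k ∈ (N.incoming d.snd).erase d, edge k ∉ M →
      N.offer (messagesOf M Γ) k ≤ N.gain M Γ d.snd := fun k hk hkM =>
    mem_incoming.1 (mem_of_mem_erase hk) ▸ h.offer_le_gain hkM
  by_cases hi : N.degreeIn M d.snd = N.cap d.snd
  · refine le_antisymm ?_ ?_
    · obtain ⟨e, he, heM, heΓ, -⟩ := exists_gain_eq (Γ := Γ) hi
      -- Dropping the partner `e` that attains the gain leaves `b - 1` offers that may exceed it.
      refine bMax_le (N.cap_pos _) (fun k => edge k ∈ M ∧ k ≠ e) (h.1.gain_nonneg _) ?_ ?_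
      · rw [← hi, ← hcard]
        refine card_lt_card ⟨fun k hk => ?_, fun hsub => ?_⟩
        · rw [mem_filter] at hk ⊢
          exact ⟨hk.1, hk.2.1⟩
        · have : e ∈ ({k ∈ (N.incoming d.snd).erase d | edge k ∈ M} : Finset N.Arc) :=
            mem_filter.2 ⟨mem_erase.2 ⟨fun hed => hd (hed ▸ heM), mem_incoming.2 he⟩, heM⟩
          exact (mem_filter.1 (hsub this)).2.2 rfl
      · intro k hk hkM
        by_cases hkM' : edge k ∈ M
        · obtain rfl : k = e := by
            by_contra hne
            exact hkM ⟨hkM', hne⟩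
          rw [h.offer_messagesOf, if_pos heM, heΓ]
        · exact hnot k hk hkM'
    · refine le_bMax (N.cap_pos _) (fun k => edge k ∈ M) hoff (by rw [hcard, hi]) fun k hk hkM => ?_
      exact mem_incoming.1 (mem_of_mem_erase hk) ▸ h.gain_le_offer hkM
  · refine le_antisymm ?_ ?_
    · refine bMax_le (N.cap_pos _) (fun k => edge k ∈ M) (h.1.gain_nonneg _) ?_ hnot
      exact hcard.trans_lt (hB.lt_of_ne hi)
    · rw [gain_of_ne hi]
      exact bMax_nonneg hoff

lemma isEquilibrium : N.IsEquilibrium (messagesOf M Γ) := by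
  refine ⟨h.messagesOf_nonneg, fun d => ?_⟩
  by_cases hd : edge d ∈ M
  · have hd' : edge d.symm ∈ M := by rwa [edge_symm]
    have h1 : messagesOf M Γ d.symm = N.bMaxOthers (outsideOption M Γ) d := by
      rw [messagesOf, if_pos hd', SimpleGraph.Dart.symm_symm]
    rw [h1]
    refine (bMaxOthers_congr h.1.1 (offer_nonneg h.messagesOf_nonneg) (fun e => ?_)
      (fun e he => ?_) (fun k l hkl hk hl => ?_) hd).symm
    · rw [h.offer_messagesOf]
      split_ifs with he
      · exact le_max_of_le_left (by linarith [h.1.gain_fst_le he, h.1.2.2.2 e he])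
      · exact le_rfl
    · rw [h.offer_messagesOf, if_neg he]
    · exact (h.offer_le_gain hl).trans (hkl ▸ h.gain_le_offer hk)
  · have hd' : edge d.symm ∉ M := by rwa [edge_symm]
    rw [h.bMaxOthers_offer_of_notMem hd]
    exact if_neg hd'

lemma isTopOffers : N.IsTopOffers (N.offer (messagesOf M Γ)) Γ := by
  intro i
  have hB := h.1.1 i
  have hdeg := degreeIn_eq_card M i
  have hsub := filter_subset (fun d : N.Arc => edge d ∈ M) (N.incoming i)
  -- Any extension of the partners to the required size works: extra members occur only at
  -- unsaturated vertices, where non-partners offer `0`.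
  obtain ⟨T, hMT, hT, hcard⟩ := exists_subsuperset_card_eq hsub
    (n := min (N.cap i) #(N.incoming i))
    (le_min (hdeg ▸ hB) (card_le_card hsub)) (min_le_right _ _)
  have hMT' : ∀ e ∈ N.incoming i, edge e ∈ M → e ∈ T := fun e he heM =>
    hMT (mem_filter.2 ⟨he, heM⟩)
  refine ⟨T, hT, hcard, fun d hd e he => ?_, fun d hd => ?_⟩
  · obtain ⟨he, heT⟩ := mem_sdiff.1 he
    have heM : edge e ∉ M := fun heM => heT (hMT' e he heM)
    have he' := mem_incoming.1 he
    have h1 := h.offer_le_gain heM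
    by_cases hdM : edge d ∈ M
    · have hd' := mem_incoming.1 (hT hd)
      refine h1.trans ?_
      rw [he', ← hd']
      exact h.gain_le_offer hdM
    · rw [he', gain_of_ne] at h1
      · exact h1.trans (offer_nonneg h.messagesOf_nonneg d)
      · intro hi
        have h2 := eq_of_subset_of_card_le hMT (by omega)
        rw [← h2] at hd
        exact hdM (mem_filter.1 hd).2
  · by_cases hdM : edge d ∈ M
    · rw [if_pos (hMT' d hd hdM), h.offer_messagesOf, if_pos hdM]
    · rw [h.1.2.2.1 d hdM]
      split_ifs with hdT
      · have h1 := h.offer_le_gain hdM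
        rw [mem_incoming.1 hd, gain_of_ne] at h1
        · exact le_antisymm (offer_nonneg h.messagesOf_nonneg d) h1
        · intro hi
          have h2 := eq_of_subset_of_card_le hMT (by omega)
          rw [← h2] at hdT
          exact hdM (mem_filter.1 hdT).2
      · rfl

end IsNashBargaining

end Nash

end BargainingNetwork

theorem mainTheorem10 {V : Type*} [Fintype V] (N : BargainingNetwork V)
    (κ : ℝ) (hκ : κ ∈ Set.Ioo (0 : ℝ) 1)
    (Mstar : Finset N.graph.edgeSet)
    (hM : ∀ x : N.graph.edgeSet → ℝ, N.IsLPOptimum x ↔ x = N.edgeIndicator Mstar) :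
    (∀ s : N.State, N.IsFixedPoint κ s →
      N.Induces s.α Mstar ∧ N.IsNashBargaining Mstar s.Γ) ∧
    (∀ (M : Finset N.graph.edgeSet) (Γ : N.Arc → ℝ), N.IsNashBargaining M Γ →
      M = Mstar ∧ ∃! s : N.State, N.IsFixedPoint κ s ∧ s.Γ = Γ) := by
  have hB : N.IsBMatching Mstar :=
    BargainingNetwork.isLPFeasible_edgeIndicator.1 ((hM _).2 rfl).1
  have heq : ∀ s : N.State, N.IsFixedPoint κ s → N.IsEquilibrium s.α := fun s hs =>
    ⟨hs.1, (BargainingNetwork.isFixedPt_update_iff hκ.1).1 hs.2.1⟩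
  have htop : ∀ s : N.State, N.IsFixedPoint κ s → N.IsTopOffers (N.offer s.α) s.Γ :=
    fun s hs => hs.2.2.1 ▸ hs.2.2.2
  refine ⟨fun s hs => ?_, fun M Γ hN => ?_⟩
  · have hslack := (heq s hs).slack_pos_and_neg hM
    exact ⟨(heq s hs).induces hB (fun d => (hslack d).1) (fun d => (hslack d).2),
      (heq s hs).isNashBargaining hB (fun d => (hslack d).1) (fun d => (hslack d).2) (htop s hs)⟩
  · obtain rfl : M = Mstar :=
      BargainingNetwork.edgeIndicator_injective ((hM _).1 (hN.1.isLPOptimum hN.2.1))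
    refine ⟨rfl, ⟨BargainingNetwork.messagesOf M Γ, N.offer (BargainingNetwork.messagesOf M Γ), Γ⟩,
      ⟨⟨hN.messagesOf_nonneg, (BargainingNetwork.isFixedPt_update_iff hκ.1).2 hN.isEquilibrium.eq,
        rfl, hN.isTopOffers⟩, rfl⟩, ?_⟩
    rintro s ⟨hs, rfl⟩
    have hslack := (heq s hs).slack_pos_and_neg hM
    have h1 := (heq s hs).eq_messagesOf hB (fun d => (hslack d).1) (fun d => (hslack d).2)
      (htop s hs)
    have h2 := hs.2.2.1
    obtain ⟨α, m, Γ⟩ := s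
    simp only at h1 h2
    subst h2
    rw [BargainingNetwork.State.mk.injEq]
    exact ⟨h1, congrArg N.offer h1, rfl⟩
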